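/- For a fixed integer $r\ge 2$, call a sequence $(a(n))_{n\in\mathbb Z}$ an *order-$r$ window sequence* if $a(k)=0$ for $k\le 0$, the terms $a(1)\le a(2)\le\cdots$ are positive integers, and \[ a\bigl(a(n)+a(n-1)+\cdots+a(n-r+1)\bigr)=n\qquad\text{for all } n\ge 1 . \] The *almost Golomb sequence of order $r$* is the window sequence that is minimal term by term in the greedy sense: for every $n\ge 2$ and every integer $m$ with $a(n-1)\le m<a(n)$, there is no order-$r$ window sequence $c$ with $c(k)=a(k)$ for all $k<n$ and $c(n)=m$. **Theorem.** There is exactly one almost Golomb sequence $(a(n))$ of order $5$, and for it the ratio $a(n)/n$ does not converge as $n\to\infty$. More precisely, put $A_k=a(5^k)$ and $B_k=a(2\cdot 5^k)$. Then for all $k\ge 2$, \[ A_{k+1}=\begin{cases}5A_k-1,& k\text{ even},\\ 5A_k-4,& k\text{ odd},\end{cases} \qquad B_{k+1}=5B_k-1 . \] Moreover \[ \lim_{\substack{k\to\infty\\ k\text{ even}}}\frac{a(5^k)}{5^k}=\frac{93}{200},\qquad \lim_{k\to\infty}\frac{a(2\cdot 5^k)}{2\cdot 5^k}=\frac{87}{200},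 \] and these two limits are distinct. -/

import Mathlib

open Filter Topology

/-- A nondecreasing sequence of positive integers `a(1), a(2), …`, extended by `a(k) = 0` for
`k ≤ 0`, that satisfies the sliding-window rule `a(a(n) + a(n-1) + ⋯ + a(n-r+1)) = n` for every
`n ≥ 1`. -/
structure IsWindowSequence (r : ℕ) (a : ℤ → ℕ) : Prop where
  zero_of_nonpos : ∀ k : ℤ, k ≤ 0 → a k = 0
  pos : ∀ n : ℤ, 1 ≤ n → 0 < a n
  mono : ∀ m n : ℤ, 1 ≤ m → m ≤ n → a m ≤ a n
  window : ∀ n : ℤ, 1 ≤ n → (a (∑ j ∈ Finset.range r, (a (n - (j : ℤ)) : ℤ)) : ℤ) = n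

/-- The almost Golomb sequence of order `r` (for `r ≥ 2`): the window sequence obtained by always
choosing `a(n)` minimal. For every `n ≥ 2`, no integer `m` with `a(n-1) ≤ m < a(n)` could have been
chosen as the `n`-th term: no window sequence has the same terms before `n` and `n`-th term `m`.
(As the rule refers to terms beyond the `n`-th one, a candidate `m` is tested on the continuations
of `a(1), …, a(n-1), m`, not on the terms of `a` itself, which contain the larger choice `a(n)`.) -/
structure IsAlmostGolomb (r : ℕ) (a : ℤ → ℕ) : Prop extends IsWindowSequence r a where
  minimal : ∀ n : ℤ, 2 ≤ n → ∀ m : ℕ, a (n - 1) ≤ m → m < a n →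
    ¬ ∃ c : ℤ → ℕ, IsWindowSequence r c ∧ (∀ k : ℤ, k < n → c k = a k) ∧ c n = m

/-! Write `g` for `golomb` and `W` for its window sum. A value `v` is kept until the index reaches
`W (v + 1)`, so `g` inverts `W`: `g m = n` when `n ≥ 2` and `W n ≤ m < W (n + 1)`. This forces
minimality: if a window sequence `c` agrees with `g` before `n ≥ 3`, then `c (W (g n)) = g n` and `W
(g n) ≤ n`, so `c n ≥ g n` by monotonicity.

Values near `x` fix the window sums there, hence by inversion the values near `5 * g x`; a second
inversion gives those near `5 * x`. So `g (5 * x) = 5 * g x + c`, with `c` depending only on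
differences of `g` around `x` (`LooksLike.five_mul`). Along `5 ^ k` two patterns alternate, with `c
= -1` and `c = -4`; along `2 * 5 ^ k` one pattern persists, with `c = -1`. The values at 25 and 50
then lead to different limits. -/

/-! ### The lazy sequence as inverse of its window sums -/

/-- The sum of the five terms of `f` ending at `n`; for `f 0 = 0` the truncated subtraction
agrees with the extension of `f` by `0`. -/
def windowSum (f : ℕ → ℕ) (n : ℕ) : ℕ :=
  f n + f (n - 1) + f (n - 2) + f (n - 3) + f (n - 4)

/-- The terms `0, …, n + 3` of the lazy sequence: a value `v ≥ 2` is kept until the index reaches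
the window sum at `v + 1`. -/
def golombList : ℕ → List ℕ
  | 0 => [0, 1, 2, 2]
  | n + 1 => golombList n ++
      [if windowSum (fun i => (golombList n).getD i 0) ((golombList n).getD (n + 3) 0 + 1) = n + 4
        then (golombList n).getD (n + 3) 0 + 1 else (golombList n).getD (n + 3) 0]

def golomb (n : ℕ) : ℕ := (golombList n).getD n 0

lemma length_golombList (n : ℕ) : (golombList n).length = n + 4 := by
  induction n with
  | zero => rfl
  | succ n ih => simp [golombList, ih]

lemma golombList_getD_add {m n : ℕ} (h : m < n + 4) (d : ℕ) :
    (golombList (n + d)).getD m 0 = (golombList n).getD m 0 := by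
  induction d with
  | zero => rfl
  | succ d ih =>
    rw [← ih, ← add_assoc, golombList, List.getD_append]
    rw [length_golombList]; omega

lemma golombList_getD {m n : ℕ} (h : m < n + 4) : (golombList n).getD m 0 = golomb m := by
  rcases le_total m n with hmn | hmn
  · obtain ⟨d, rfl⟩ := Nat.exists_eq_add_of_le hmn
    exact golombList_getD_add (by omega) d
  · obtain ⟨d, rfl⟩ := Nat.exists_eq_add_of_le hmn
    exact (golombList_getD_add h d).symm

lemma golomb_succ_eq_ite_getD {n : ℕ} (hn : 3 ≤ n) :
    golomb (n + 1) = if windowSum (fun i => (golombList (n - 3)).getD i 0) (golomb n + 1) = n + 1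
      then golomb n + 1 else golomb n := by
  obtain ⟨k, rfl⟩ := Nat.exists_eq_add_of_le' hn
  have h := golombList_getD (m := k + 3 + 1) (n := k + 1) (by omega)
  rw [← h, golombList, List.getD_append_right _ _ _ _ (by rw [length_golombList]),
    length_golombList, golombList_getD (m := k + 3) (by omega)]
  simp

lemma golomb_succ_le {n : ℕ} (hn : 3 ≤ n) : golomb (n + 1) ≤ golomb n + 1 := by
  rw [golomb_succ_eq_ite_getD hn]; split_ifs <;> omega

lemma golomb_lt {n : ℕ} (hn : 3 ≤ n) : golomb n < n := by
  induction n, hn using Nat.le_induction with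
  | base => decide
  | succ n hn ih => have := golomb_succ_le hn; omega

lemma golomb_add_two_le {n : ℕ} (hn : 4 ≤ n) : golomb n + 2 ≤ n := by
  induction n, hn using Nat.le_induction with
  | base => decide
  | succ n hn ih => have := golomb_succ_le (n := n) (by omega); omega

lemma golomb_succ {n : ℕ} (hn : 3 ≤ n) :
    golomb (n + 1) = if windowSum golomb (golomb n + 1) = n + 1
      then golomb n + 1 else golomb n := by
  -- The test reads indices up to `golomb n + 1 ≤ n`, all present in the shorter list.
  have hlt := golomb_lt hn
  have hw : windowSum (fun i => (golombList (n - 3)).getD i 0) (golomb n + 1) =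
      windowSum golomb (golomb n + 1) := by
    simp only [windowSum]
    iterate 5 rw [golombList_getD (by omega)]
  rw [golomb_succ_eq_ite_getD hn, hw]

lemma golomb_le_succ (n : ℕ) : golomb n ≤ golomb (n + 1) := by
  rcases Nat.lt_or_ge n 3 with hn | hn
  · interval_cases n <;> decide
  · rw [golomb_succ hn]; split_ifs <;> omega

lemma golomb_mono : Monotone golomb := monotone_nat_of_le_succ golomb_le_succ

lemma golomb_le_pred_add_one (n : ℕ) : golomb n ≤ golomb (n - 1) + 1 := by
  rcases Nat.lt_or_ge n 4 with hn | hn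
  · interval_cases n <;> decide
  · obtain ⟨k, rfl⟩ := Nat.exists_eq_add_of_le' hn
    exact golomb_succ_le (by omega)

lemma golomb_pos {n : ℕ} (hn : 1 ≤ n) : 0 < golomb n :=
  (by decide : 0 < golomb 1).trans_le (golomb_mono hn)

lemma windowSum_golomb_succ (n : ℕ) :
    windowSum golomb (n + 1) + golomb (n - 4) = windowSum golomb n + golomb (n + 1) := by
  simp only [windowSum, Nat.add_sub_cancel, Nat.reduceSubDiff]
  omega

lemma golomb_le_add_five (n : ℕ) : golomb (n + 1) ≤ golomb (n - 4) + 5 := by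
  have h0 := golomb_le_pred_add_one (n + 1)
  have h1 := golomb_le_pred_add_one n
  have h2 := golomb_le_pred_add_one (n - 1)
  have h3 := golomb_le_pred_add_one (n - 1 - 1)
  have h4 := golomb_le_pred_add_one (n - 1 - 1 - 1)
  simp only [Nat.add_sub_cancel, Nat.sub_sub, Nat.reduceAdd] at *
  omega

/-- The upper bound needs `W` to increase, that is, no six equal consecutive terms. By the bounds at
smaller indices, six terms equal to `v` would give `W (v + 1) - W v ≥ 6`; but `W` grows by at most 5
because `golomb` has steps at most 1. -/
lemma golomb_bounds {n : ℕ} (hn : 3 ≤ n) :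
    windowSum golomb (golomb n) ≤ n ∧ n < windowSum golomb (golomb n + 1) := by
  induction n using Nat.strong_induction_on with
  | _ n ih =>
  rcases Nat.lt_or_ge n 9 with hn9 | hn9
  · interval_cases n <;> decide
  obtain ⟨k, rfl⟩ : ∃ k, n = k + 1 := ⟨n - 1, by omega⟩
  obtain ⟨h1, h2⟩ := ih k (by omega) (by omega)
  rw [golomb_succ (by omega)]
  split_ifs with h
  · refine ⟨h.le, ?_⟩
    have key := windowSum_golomb_succ (golomb k + 1)
    suffices golomb (golomb k + 1 - 4) < golomb (golomb k + 1 + 1) by omega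
    have hlt := golomb_add_two_le (n := k) (by omega)
    have hk : golomb 8 ≤ golomb k := golomb_mono (by omega)
    have hk8 : golomb 8 = 4 := by decide
    refine (golomb_mono (by omega)).lt_of_ne fun heq => ?_
    -- The induction hypothesis requires `golomb k + 1 - 4 ≥ 3`; the smaller values are checked
    -- directly.
    rcases Nat.lt_or_ge (golomb k) 6 with hs | hs
    · interval_cases golomb k <;> revert heq <;> decide
    have b1 := (ih (golomb k + 1 - 4) (by omega) (by omega)).1
    have b2 := (ih (golomb k + 1 + 1) (by omega) (by omega)).2
    rw [← heq] at b2
    have := windowSum_golomb_succ (golomb (golomb k + 1 - 4))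
    have := golomb_le_add_five (golomb (golomb k + 1 - 4))
    omega
  · omega

lemma windowSum_golomb_lt_succ (n : ℕ) : windowSum golomb n < windowSum golomb (n + 1) := by
  have key := windowSum_golomb_succ n
  suffices golomb (n - 4) < golomb (n + 1) by omega
  rcases Nat.lt_or_ge n 7 with hs | hs
  · interval_cases n <;> decide
  refine (golomb_mono (by omega)).lt_of_ne fun heq => ?_
  have b1 := (golomb_bounds (n := n - 4) (by omega)).1
  have b2 := (golomb_bounds (n := n + 1) (by omega)).2
  rw [← heq] at b2
  have := windowSum_golomb_succ (golomb (n - 4))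
  have := golomb_le_add_five (golomb (n - 4))
  omega

lemma windowSum_golomb_strictMono : StrictMono (windowSum golomb) :=
  strictMono_nat_of_lt_succ windowSum_golomb_lt_succ

lemma golomb_eq_of_windowSum {m n : ℕ} (hn : 2 ≤ n) (h1 : windowSum golomb n ≤ m)
    (h2 : m < windowSum golomb (n + 1)) : golomb m = n := by
  have h3 : windowSum golomb 2 ≤ windowSum golomb n := windowSum_golomb_strictMono.monotone hn
  have h4 : windowSum golomb 2 = 3 := by decide
  obtain ⟨h5, h6⟩ := golomb_bounds (n := m) (by omega)
  have := windowSum_golomb_strictMono.lt_iff_lt.1 (h1.trans_lt h6)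
  have := windowSum_golomb_strictMono.lt_iff_lt.1 (h5.trans_lt h2)
  omega

/-! ### Minimality and uniqueness -/

lemma IsWindowSequence.monotone {r : ℕ} {a : ℤ → ℕ} (ha : IsWindowSequence r a) : Monotone a := by
  intro m n hmn
  rcases le_or_gt m 0 with hm | hm
  · simp [ha.zero_of_nonpos m hm]
  · exact ha.mono m n hm hmn

/-- The sequence `golomb`, extended by `0` to the integers. -/
def golombInt (k : ℤ) : ℕ := golomb k.toNat

lemma golombInt_natCast (n : ℕ) : golombInt n = golomb n := by simp [golombInt]

lemma sum_window_golombInt (n : ℕ) :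
    ∑ j ∈ Finset.range 5, (golombInt ((n : ℤ) - (j : ℤ)) : ℤ) = windowSum golomb n := by
  simp only [Finset.sum_range_succ, Finset.sum_range_zero, golombInt, windowSum]
  push_cast
  have h (j : ℕ) : ((n : ℤ) - (j : ℤ)).toNat = n - j := by omega
  have h1 := h 1
  have h2 := h 2
  have h3 := h 3
  have h4 := h 4
  push_cast at h1 h2 h3 h4
  simp [h1, h2, h3, h4]

lemma golombInt_eq_of_sum_window {n m : ℕ} (hn : 2 ≤ n)
    (h1 : ∑ j ∈ Finset.range 5, (golombInt ((n : ℤ) - (j : ℤ)) : ℤ) ≤ m)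
    (h2 : (m : ℤ) < ∑ j ∈ Finset.range 5, (golombInt ((n + 1 : ℕ) - (j : ℤ)) : ℤ)) :
    golombInt m = n := by
  rw [sum_window_golombInt] at h1 h2
  rw [golombInt_natCast]
  exact golomb_eq_of_windowSum hn (by exact_mod_cast h1) (by exact_mod_cast h2)

lemma isWindowSequence_golombInt : IsWindowSequence 5 golombInt where
  zero_of_nonpos k hk := by simp [golombInt, Int.toNat_of_nonpos hk]; rfl
  pos n hn := golomb_pos (by omega)
  mono m n _ hmn := golomb_mono (by omega)
  window n hn := by
    lift n to ℕ using by omega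
    rw [sum_window_golombInt, golombInt_natCast]
    rcases Nat.lt_or_ge n 2 with h | h
    · obtain rfl : n = 1 := by omega
      decide
    · rw [golomb_eq_of_windowSum h le_rfl (windowSum_golomb_lt_succ n)]

lemma IsWindowSequence.apply_one {a : ℤ → ℕ} (ha : IsWindowSequence 5 a) : a 1 = 1 := by
  have hw := ha.window 1 le_rfl
  have hp := ha.pos 1 le_rfl
  simp only [Finset.sum_range_succ, Finset.sum_range_zero] at hw
  norm_num [ha.zero_of_nonpos] at hw
  have := ha.mono 1 (a 1) le_rfl (by omega)
  omega

/-- If `a 2 = 1`, the window at 2 has sum 2, and the rule gives `a 2 = 2`. -/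
lemma IsWindowSequence.two_le_apply_two {a : ℤ → ℕ} (ha : IsWindowSequence 5 a) : 2 ≤ a 2 := by
  have hw := ha.window 2 (by norm_num)
  have hp := ha.pos 2 (by norm_num)
  have h1 := ha.apply_one
  simp only [Finset.sum_range_succ, Finset.sum_range_zero] at hw
  norm_num [ha.zero_of_nonpos, h1] at hw
  by_contra h
  have h2 : a 2 = 1 := by omega
  rw [h2] at hw
  norm_num [h2] at hw

/-- Among the window sequences with given terms before `n`, the `n`-th term of `golombInt` is
least. -/
lemma golombInt_le_of_eq_below {c : ℤ → ℕ} (hc : IsWindowSequence 5 c) {n : ℤ} (hn : 1 ≤ n)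
    (h : ∀ k < n, c k = golombInt k) : golombInt n ≤ c n := by
  lift n to ℕ using by omega
  rcases Nat.lt_or_ge n 3 with h3 | h3
  · interval_cases n
    · omega
    · exact hc.pos 1 le_rfl
    · exact hc.two_le_apply_two
  have hlt := golomb_lt h3
  have hg : 0 < golomb n := golomb_pos (by omega)
  have hw := hc.window (golomb n) (by omega)
  -- Since `golomb n < n`, this window lies where `c` and `golombInt` agree.
  have hs : ∑ j ∈ Finset.range 5, (c ((golomb n : ℤ) - (j : ℤ)) : ℤ) =
      windowSum golomb (golomb n) := by
    rw [← sum_window_golombInt]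
    exact Finset.sum_congr rfl fun j _ => by rw [h _ (by omega)]
  rw [hs] at hw
  have hle : (windowSum golomb (golomb n) : ℤ) ≤ n := by exact_mod_cast (golomb_bounds h3).1
  have := hc.monotone hle
  rw [golombInt_natCast]
  omega

lemma isAlmostGolomb_golombInt : IsAlmostGolomb 5 golombInt where
  toIsWindowSequence := isWindowSequence_golombInt
  minimal n hn m _ hm := by
    rintro ⟨c, hc, hcn, rfl⟩
    exact (golombInt_le_of_eq_below hc (by omega) hcn).not_gt hm

lemma IsAlmostGolomb.eq_golombInt {a : ℤ → ℕ} (ha : IsAlmostGolomb 5 a) : a = golombInt := by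
  have hnat (n : ℕ) : a n = golombInt n := by
    induction n using Nat.strong_induction_on with
    | _ n ih =>
    have below : ∀ k : ℤ, k < n → a k = golombInt k := by
      intro k hk
      rcases le_or_gt k 0 with h0 | h0
      · rw [ha.zero_of_nonpos k h0, isWindowSequence_golombInt.zero_of_nonpos k h0]
      · lift k to ℕ using h0.le
        exact ih k (by omega)
    rcases Nat.lt_or_ge n 2 with h2 | h2
    · interval_cases n
      · rw [ha.zero_of_nonpos _ (by simp)]; rfl
      · exact ha.toIsWindowSequence.apply_one
    refine (golombInt_le_of_eq_below ha.toIsWindowSequence (by omega) below).antisymm' ?_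
    by_contra! hlt
    refine ha.minimal n (by omega) (golombInt n) ?_ hlt
      ⟨golombInt, isWindowSequence_golombInt, fun k hk => (below k hk).symm, rfl⟩
    rw [below _ (by omega)]
    exact isWindowSequence_golombInt.monotone (by omega)
  funext k
  rcases le_or_gt k 0 with h0 | h0
  · rw [ha.zero_of_nonpos k h0, isWindowSequence_golombInt.zero_of_nonpos k h0]
  · lift k to ℕ using h0.le
    exact hnat k

/-! ### Propagation of local patterns from `x` to `5 * x` -/

/-- The sum of the five values of `f` ending at `n`. -/
def slidingSum (f : ℤ → ℤ) (n : ℤ) : ℤ :=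
  f n + f (n - 1) + f (n - 2) + f (n - 3) + f (n - 4)

lemma golombInt_eq_of_slidingSum {n m : ℤ} (hn : 2 ≤ n)
    (h1 : slidingSum (fun k => golombInt k) n ≤ m)
    (h2 : m < slidingSum (fun k => golombInt k) (n + 1)) : (golombInt m : ℤ) = n := by
  lift n to ℕ using by omega
  have h0 : 0 ≤ slidingSum (fun k => golombInt k) n := by
    simp only [slidingSum]; positivity
  lift m to ℕ using by omega
  have hsum (k : ℤ) : slidingSum (fun k => golombInt k) k =
      ∑ j ∈ Finset.range 5, (golombInt (k - (j : ℤ)) : ℤ) := by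
    simp [slidingSum, Finset.sum_range_succ]
  rw [hsum] at h1 h2
  exact_mod_cast golombInt_eq_of_sum_window (by omega) h1 (by exact_mod_cast h2)

/-- On the offsets from `lo` to `hi`, the values of `golombInt` around `x` are `y + p i`. -/
def HasPattern (x y lo hi : ℤ) (p : ℤ → ℤ) : Prop :=
  ∀ i, lo ≤ i → i ≤ hi → (golombInt (x + i) : ℤ) = y + p i

/-- `q` is the inverse of the window sums of the pattern `p`. -/
def IsNextPattern (lo hi : ℤ) (p : ℤ → ℤ) (lo' hi' : ℤ) (q : ℤ → ℤ) : Prop :=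
  ∀ t ∈ Finset.Icc lo' hi', lo + 4 ≤ q t ∧ q t + 1 ≤ hi ∧
    slidingSum p (q t) ≤ t ∧ t < slidingSum p (q t + 1)

noncomputable instance (lo hi : ℤ) (p : ℤ → ℤ) (lo' hi' : ℤ) (q : ℤ → ℤ) :
    Decidable (IsNextPattern lo hi p lo' hi' q) :=
  by unfold IsNextPattern; infer_instance

lemma HasPattern.slidingSum_eq {x y lo hi : ℤ} {p : ℤ → ℤ} (h : HasPattern x y lo hi p) {i : ℤ}
    (h1 : lo + 4 ≤ i) (h2 : i ≤ hi) :
    slidingSum (fun k => golombInt k) (x + i) = 5 * y + slidingSum p i := by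
  simp only [slidingSum, add_sub_assoc]
  rw [h i (by omega) h2, h (i - 1) (by omega) (by omega), h (i - 2) (by omega) (by omega),
    h (i - 3) (by omega) (by omega), h (i - 4) (by omega) (by omega)]
  ring

lemma HasPattern.next {x y lo hi lo' hi' : ℤ} {p q : ℤ → ℤ} (h : HasPattern x y lo hi p)
    (hx : 0 ≤ x + lo) (hq : IsNextPattern lo hi p lo' hi' q) :
    HasPattern (5 * y) x lo' hi' q := by
  intro t ht1 ht2
  obtain ⟨h1, h2, h3, h4⟩ := hq t (Finset.mem_Icc.2 ⟨ht1, ht2⟩)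
  apply golombInt_eq_of_slidingSum (by omega)
  · rw [h.slidingSum_eq h1 (by omega)]; omega
  · rw [add_assoc, h.slidingSum_eq (by omega) h2]; omega

/-- The function with values `l` at `lo, lo + 1, …`. -/
def patternOf (lo : ℤ) (l : List ℤ) (i : ℤ) : ℤ := l.getD (i - lo).toNat 0

/-- The differences `golombInt (x + i) - golombInt x`, for `-6 ≤ i ≤ 3`, are the entries of `l`. -/
def LooksLike (x : ℤ) (l : List ℤ) : Prop :=
  HasPattern x (golombInt x) (-6) 3 (patternOf (-6) l)

/-- Near `x` the sequence determines itself near `5 * x`. -/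
lemma LooksLike.five_mul {x lo hi c : ℤ} {l l' : List ℤ} (h : LooksLike x l) {q : ℤ → ℤ}
    (hx : 25 ≤ x) (hlo : -11 ≤ lo)
    (h1 : IsNextPattern (-6) 3 (patternOf (-6) l) lo hi q)
    (h2 : IsNextPattern lo hi q (-6) 3 (fun i => patternOf (-6) l' i + c))
    (h0 : patternOf (-6) l' 0 = 0) :
    LooksLike (5 * x) l' ∧ (golombInt (5 * x) : ℤ) = 5 * golombInt x + c := by
  -- With `-11 ≤ lo`, this keeps the intermediate indices `5 * golombInt x + lo` nonnegative.
  have hy : golombInt 25 ≤ golombInt x := isWindowSequence_golombInt.monotone hx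
  have hy25 : golombInt 25 = 12 := by decide +kernel
  have key := (HasPattern.next h (by omega) h1).next (by omega) h2
  have hc : (golombInt (5 * x) : ℤ) = 5 * golombInt x + c := by
    have := key 0 (by norm_num) (by norm_num)
    rw [add_zero] at this
    simp only [this, h0]; ring
  refine ⟨fun i hi1 hi2 => ?_, hc⟩
  rw [key i hi1 hi2, hc]; ring

/-! ### Patterns at `5 ^ k` and `2 * 5 ^ k` -/

lemma looksLike_twentyFive : LooksLike 25 [-3, -2, -2, -1, -1, 0, 0, 1, 1, 1] := by
  have h : ∀ i ∈ Finset.Icc (-6 : ℤ) 3, (golombInt (25 + i) : ℤ) =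
      golombInt 25 + patternOf (-6) [-3, -2, -2, -1, -1, 0, 0, 1, 1, 1] i := by decide +kernel
  exact fun i h1 h2 => h i (Finset.mem_Icc.2 ⟨h1, h2⟩)

lemma looksLike_fifty : LooksLike 50 [-2, -2, -1, -1, -1, 0, 0, 1, 1, 1] := by
  have h : ∀ i ∈ Finset.Icc (-6 : ℤ) 3, (golombInt (50 + i) : ℤ) =
      golombInt 50 + patternOf (-6) [-2, -2, -1, -1, -1, 0, 0, 1, 1, 1] i := by decide +kernel
  exact fun i h1 h2 => h i (Finset.mem_Icc.2 ⟨h1, h2⟩)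

/-- At 25 the last difference is 1, not the 2 of the recurring even pattern, so this step is
separate. Its image is already the odd pattern. -/
lemma looksLike_oneHundredTwentyFive :
    LooksLike 125 [-3, -3, -2, -2, -1, -1, 0, 0, 1, 1] ∧
      (golombInt 125 : ℤ) = 5 * golombInt 25 - 1 := by
  have h := looksLike_twentyFive.five_mul (lo := -9) (hi := 2) (c := -1)
    (l' := [-3, -3, -2, -2, -1, -1, 0, 0, 1, 1]) (by norm_num) (by norm_num)
    -- `q` records the values around `5 * golombInt 25` as offsets from 25.
    (q := patternOf (-9) [-2, -2, -2, -1, -1, 0, 0, 0, 1, 1, 2, 2]) (by decide) (by decide)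
    (by decide)
  rwa [show (5 * 25 : ℤ) = 125 by norm_num] at h

lemma LooksLike.five_mul_of_even {x : ℤ} (hx : 25 ≤ x)
    (h : LooksLike x [-3, -2, -2, -1, -1, 0, 0, 1, 1, 2]) :
    LooksLike (5 * x) [-3, -3, -2, -2, -1, -1, 0, 0, 1, 1] ∧
      (golombInt (5 * x) : ℤ) = 5 * golombInt x - 1 :=
  h.five_mul (lo := -9) (hi := 3) (c := -1) hx (by norm_num)
    (q := patternOf (-9) [-2, -2, -2, -1, -1, 0, 0, 0, 1, 1, 2, 2, 2]) (by decide) (by decide)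
    (by decide)

lemma LooksLike.five_mul_of_odd {x : ℤ} (hx : 25 ≤ x)
    (h : LooksLike x [-3, -3, -2, -2, -1, -1, 0, 0, 1, 1]) :
    LooksLike (5 * x) [-3, -2, -2, -1, -1, 0, 0, 1, 1, 2] ∧
      (golombInt (5 * x) : ℤ) = 5 * golombInt x - 4 :=
  h.five_mul (lo := -11) (hi := 0) (c := -4) hx (by norm_num)
    (q := patternOf (-11) [-2, -2, -1, -1, -1, 0, 0, 1, 1, 1, 2, 2]) (by decide) (by decide)
    (by decide)

lemma LooksLike.five_mul_of_double {x : ℤ} (hx : 25 ≤ x)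
    (h : LooksLike x [-2, -2, -1, -1, -1, 0, 0, 1, 1, 1]) :
    LooksLike (5 * x) [-2, -2, -1, -1, -1, 0, 0, 1, 1, 1] ∧
      (golombInt (5 * x) : ℤ) = 5 * golombInt x - 1 :=
  h.five_mul (lo := -7) (hi := 2) (c := -1) hx (by norm_num)
    (q := patternOf (-7) [-2, -2, -1, -1, 0, 0, 1, 1, 2, 2]) (by decide) (by decide)
    (by decide)

lemma twentyFive_le_five_pow {k : ℕ} (hk : 2 ≤ k) : (25 : ℤ) ≤ 5 ^ k :=
  (by norm_num : (25 : ℤ) = 5 ^ 2).trans_le (pow_le_pow_right₀ (by norm_num) hk)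

lemma looksLike_five_pow {k : ℕ} (hk : 3 ≤ k) :
    (Odd k → LooksLike (5 ^ k) [-3, -3, -2, -2, -1, -1, 0, 0, 1, 1]) ∧
    (Even k → LooksLike (5 ^ k) [-3, -2, -2, -1, -1, 0, 0, 1, 1, 2]) := by
  induction k, hk using Nat.le_induction with
  | base =>
    refine ⟨fun _ => ?_, fun h => absurd h (by decide)⟩
    norm_num
    exact looksLike_oneHundredTwentyFive.1
  | succ k hk ih =>
    have h25 : (25 : ℤ) ≤ 5 ^ k := twentyFive_le_five_pow (by omega)
    rw [Nat.odd_add_one, Nat.even_add_one, Nat.not_odd_iff_even, Nat.not_even_iff_odd, pow_succ']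
    exact ⟨fun h => ((ih.2 h).five_mul_of_even h25).1, fun h => ((ih.1 h).five_mul_of_odd h25).1⟩

lemma looksLike_two_mul_five_pow {k : ℕ} (hk : 2 ≤ k) :
    LooksLike (2 * 5 ^ k) [-2, -2, -1, -1, -1, 0, 0, 1, 1, 1] := by
  induction k, hk using Nat.le_induction with
  | base => exact looksLike_fifty
  | succ k hk ih =>
    have h25 : (25 : ℤ) ≤ 5 ^ k := twentyFive_le_five_pow hk
    rw [pow_succ', mul_left_comm]
    exact (ih.five_mul_of_double (by omega)).1

lemma golombInt_five_pow_succ_of_even {k : ℕ} (hk : 2 ≤ k) (he : Even k) :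
    (golombInt (5 ^ (k + 1)) : ℤ) = 5 * golombInt (5 ^ k) - 1 := by
  rcases hk.eq_or_lt with rfl | h3
  · exact looksLike_oneHundredTwentyFive.2
  · rw [pow_succ']
    exact (((looksLike_five_pow h3).2 he).five_mul_of_even (twentyFive_le_five_pow hk)).2

lemma golombInt_five_pow_succ_of_odd {k : ℕ} (hk : 2 ≤ k) (ho : Odd k) :
    (golombInt (5 ^ (k + 1)) : ℤ) = 5 * golombInt (5 ^ k) - 4 := by
  have h3 : 3 ≤ k := by
    obtain ⟨j, rfl⟩ := ho; omega
  rw [pow_succ']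
  exact (((looksLike_five_pow h3).1 ho).five_mul_of_odd (twentyFive_le_five_pow hk)).2

lemma golombInt_two_mul_five_pow_succ {k : ℕ} (hk : 2 ≤ k) :
    (golombInt (2 * 5 ^ (k + 1)) : ℤ) = 5 * golombInt (2 * 5 ^ k) - 1 := by
  have h25 : (25 : ℤ) ≤ 5 ^ k := twentyFive_le_five_pow hk
  rw [pow_succ', mul_left_comm]
  exact ((looksLike_two_mul_five_pow hk).five_mul_of_double (by omega)).2

/-! ### Closed forms and limits -/

/-- Two steps compose to `t ↦ 25 * t - 9`, with fixed point `3 / 8`; the value 12 at 25 gives `93 /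
200 = (12 - 3 / 8) / 25`. -/
lemma golombInt_five_pow_even {k : ℕ} (hk : 2 ≤ k) (he : Even k) :
    (golombInt (5 ^ k) : ℝ) = 93 / 200 * 5 ^ k + 3 / 8 := by
  obtain ⟨j, rfl⟩ : ∃ j, k = 2 * j + 2 := by
    obtain ⟨j, rfl⟩ := he; exact ⟨j - 1, by omega⟩
  clear hk he
  induction j with
  | zero =>
    have h : golombInt (5 ^ 2) = 12 := by decide +kernel
    rw [mul_zero, zero_add, h]; norm_num
  | succ j ih =>
    have h1 := golombInt_five_pow_succ_of_even (k := 2 * j + 2) (by omega) ⟨j + 1, by ring⟩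
    have h2 := golombInt_five_pow_succ_of_odd (k := 2 * j + 3) (by omega) ⟨j + 1, by ring⟩
    have h : (golombInt (5 ^ (2 * (j + 1) + 2)) : ℤ) =
        5 * (5 * golombInt (5 ^ (2 * j + 2)) - 1) - 4 := by rw [← h1, ← h2]; rfl
    have h' : (golombInt (5 ^ (2 * (j + 1) + 2)) : ℝ) =
        5 * (5 * golombInt (5 ^ (2 * j + 2)) - 1) - 4 := by exact_mod_cast h
    rw [h', ih]; ring

/-- The fixed point of `t ↦ 5 * t - 1` is `1 / 4`, and `87 / 200 = (22 - 1 / 4) / 50`. -/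
lemma golombInt_two_mul_five_pow {k : ℕ} (hk : 2 ≤ k) :
    (golombInt (2 * 5 ^ k) : ℝ) = 87 / 200 * (2 * 5 ^ k) + 1 / 4 := by
  induction k, hk using Nat.le_induction with
  | base =>
    have h : golombInt (2 * 5 ^ 2) = 22 := by decide +kernel
    rw [h]; norm_num
  | succ k hk ih =>
    have h : (golombInt (2 * 5 ^ (k + 1)) : ℝ) = 5 * golombInt (2 * 5 ^ k) - 1 := by
      exact_mod_cast golombInt_two_mul_five_pow_succ hk
    rw [h, ih]; ring

lemma tendsto_const_add_div_five_pow (L c d : ℝ) :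
    Tendsto (fun k : ℕ => L + c / (d * 5 ^ k)) atTop (𝓝 L) := by
  have h := (tendsto_pow_atTop_nhds_zero_of_lt_one (r := (1 / 5 : ℝ)) (by norm_num)
    (by norm_num)).const_mul (c / d) |>.const_add L
  rw [mul_zero, add_zero] at h
  refine h.congr fun k => ?_
  rw [one_div, inv_pow, div_mul_eq_div_div, ← div_eq_mul_inv]

lemma tendsto_golombInt_five_pow :
    Tendsto (fun k : ℕ => (golombInt (5 ^ k) : ℝ) / (5 : ℝ) ^ k)
      (atTop ⊓ 𝓟 {k : ℕ | Even k}) (𝓝 (93 / 200)) := by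
  refine ((tendsto_const_add_div_five_pow (93 / 200) (3 / 8) 1).mono_left inf_le_left).congr' ?_
  rw [EventuallyEq, eventually_inf_principal]
  filter_upwards [eventually_ge_atTop 2] with k hk he
  rw [golombInt_five_pow_even hk he]
  field_simp

lemma tendsto_golombInt_two_mul_five_pow :
    Tendsto (fun k : ℕ => (golombInt (2 * 5 ^ k) : ℝ) / (2 * (5 : ℝ) ^ k)) atTop
      (𝓝 (87 / 200)) := by
  refine (tendsto_const_add_div_five_pow (87 / 200) (1 / 4) 2).congr' ?_
  filter_upwards [eventually_ge_atTop 2] with k hk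
  rw [golombInt_two_mul_five_pow hk]
  field_simp

lemma not_tendsto_golombInt_div :
    ¬ ∃ L : ℝ, Tendsto (fun n : ℕ => (golombInt (n : ℤ) : ℝ) / (n : ℝ)) atTop (𝓝 L) := by
  rintro ⟨L, hL⟩
  have hpow : Tendsto (fun k : ℕ => 5 ^ k) atTop atTop :=
    tendsto_pow_atTop_atTop_of_one_lt (by norm_num)
  have hne : (atTop ⊓ 𝓟 {k : ℕ | Even k}).NeBot := by
    rw [← frequently_iff_neBot]
    exact Nat.frequently_even
  have h1 := (hL.comp hpow).mono_left (inf_le_left : atTop ⊓ 𝓟 {k : ℕ | Even k} ≤ atTop)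
  have h2 := hL.comp (hpow.const_mul_atTop' (by norm_num : 0 < 2))
  have e1 : L = 93 / 200 := tendsto_nhds_unique h1
    (tendsto_golombInt_five_pow.congr fun k => by simp)
  have e2 : L = 87 / 200 := tendsto_nhds_unique h2
    (tendsto_golombInt_two_mul_five_pow.congr fun k => by simp)
  norm_num [e1] at e2

theorem mainTheorem10 :
    (∃! a : ℤ → ℕ, IsAlmostGolomb 5 a) ∧
    ∀ a : ℤ → ℕ, IsAlmostGolomb 5 a →
      (¬ ∃ L : ℝ, Tendsto (fun n : ℕ => (a (n : ℤ) : ℝ) / (n : ℝ)) atTop (𝓝 L)) ∧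
      (∀ k : ℕ, 2 ≤ k →
        (Even k → (a (5 ^ (k + 1)) : ℤ) = 5 * (a (5 ^ k) : ℤ) - 1) ∧
        (Odd k → (a (5 ^ (k + 1)) : ℤ) = 5 * (a (5 ^ k) : ℤ) - 4) ∧
        (a (2 * 5 ^ (k + 1)) : ℤ) = 5 * (a (2 * 5 ^ k) : ℤ) - 1) ∧
      Tendsto (fun k : ℕ => (a (5 ^ k) : ℝ) / (5 : ℝ) ^ k)
        (atTop ⊓ 𝓟 {k : ℕ | Even k}) (𝓝 (93 / 200)) ∧
      Tendsto (fun k : ℕ => (a (2 * 5 ^ k) : ℝ) / (2 * (5 : ℝ) ^ k)) atTop (𝓝 (87 / 200)) ∧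
      (93 / 200 : ℝ) ≠ 87 / 200 := by

  refine ⟨⟨golombInt, isAlmostGolomb_golombInt, fun a ha => ha.eq_golombInt⟩, fun a ha => ?_⟩
  rw [ha.eq_golombInt]
  exact ⟨not_tendsto_golombInt_div,
    fun k hk => ⟨golombInt_five_pow_succ_of_even hk, golombInt_five_pow_succ_of_odd hk,
      golombInt_two_mul_five_pow_succ hk⟩,
    tendsto_golombInt_five_pow, tendsto_golombInt_two_mul_five_pow, by norm_num⟩
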